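/- Let $\mathcal L=\mathbb Z(2^\infty)=\{m/2^n : n\in\mathbb N_0,\ m\in\mathbb Z,\ 0\le m<2^n\}$ with addition modulo $1$ (the Prüfer $2$-group), regarded as a discrete group, and for $n\ge 0$ let $\mathcal M_n=\{m/2^n: m\in\mathbb Z,\ 0\le m<2^n\}$, a subgroup of order $2^n$. Let $\widehat{\mathcal L}$ be the compact dual group of $\mathcal L$ with Haar measure $d\tau$ of total mass $1$, write $e(k,\tau)=\tau(k)$ for $k\in\mathcal L$, $\tau\in\widehat{\mathcal L}$, and put $\mathcal M^\perp=\{\tau\in\widehat{\mathcal L}: e(k,\tau)=1\text{ for all }k\in\mathcal M\}$ for a subgroup $\mathcal M\le\mathcal L$. For a nonempty finite set $\Gamma\subset\mathcal L$ let $$g_\Gamma(\tau)=\frac1{\operatorname{card}\Gamma}\Big|\sum_{k\in\Gamma}e(k,\tau)\Big|^2 .$$ For $\psi\in\ell^2(\mathcal L)$ let $\widehat\psi\in L^2(\widehat{\mathcal L})$ be its Fourier transform, i.e. the extension by continuity of $\widehat\psi(\tau)=\sum_{k\in\mathcal L}\psi(k)\overline{e(k,\tau)}$. Let $p_\psi=|\widehat\psi|^2$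 (this is the periodization function of $\psi$ when the ambient group is $\mathcal L$ itself), and let $(T_k\psi)(x)=\psi(x-k)$. A family $(f_i)_{i\in I}$ of nonzero vectors of a normed space is called democratic if there is a constant $D\in(0,\infty)$ such that $\big\|\sum_{i\in\Gamma_1}f_i/\|f_i\|\big\|\le D\,\big\|\sum_{i\in\Gamma_2}f_i/\|f_i\|\big\|$ for all finite $\Gamma_1,\Gamma_2\subseteq I$ with $\operatorname{card}\Gamma_1=\operatorname{card}\Gamma_2$. There exists $\psi\in\ell^2(\mathcal L)$ for which $p_\psi$ is equal almost everywhere to the indicator function of $$\bigcup_{i=0}^\infty\big(\mathcal M_{2i}^\perp\setminus\mathcal M_{2i+1}^\perp\big),$$ and there exists a sequence $(s_n)_{n\ge1}$ with $s_n\in\mathcal M_n\setminus\mathcal M_{n-1}$ for every $n\ge 1$. For every such $\psi$ all translates $T_k\psi$ are nonzero, all functions $g_\Gamma p_\psi$ are integrable, and the following hold. 1. For every such sequence $(s_n)$ and every $n\ge1$, the set $\Gamma_n=\{0,s_1\}+\{0,s_3\}+\cdots+\{0,s_{2n-1}\}$ satisfies $$\int_{\widehat{\mathcal L}}g_{\Gamma_n}(\tau)\,p_\psi(\tau)\,d\tau\le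 2^{-n+1}.$$ Consequently, $\inf_\Gamma\int_{\widehat{\mathcal L}}g_\Gamma p_\psi\,d\tau=0$, the infimum being over all nonempty finite $\Gamma\subset\mathcal L$, and the family of translates $(T_k\psi)_{k\in\mathcal L}$ is not democratic in $\ell^2(\mathcal L)$. 2. For every $n\ge0$ the integral $\int_{\widehat{\mathcal L}}g_{\mathcal M_n}(\tau)\,p_\psi(\tau)\,d\tau$ equals $2/3$ if $n$ is even and $1/3$ if $n$ is odd, and $$\int_{\widehat{\mathcal L}}g_{\mathcal M}(\tau)\,p_\psi(\tau)\,d\tau\ge\frac13\qquad\text{for every finite subgroup }\mathcal M\le\mathcal L.$$ Hence testing the condition $\inf_\Gamma\int g_\Gamma p_\psi>0$ on finite subgroups only does not suffice for democracy. -/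

import Mathlib

open MeasureTheory Complex
open scoped Pointwise ENNReal

noncomputable section

namespace LatticeTranslates

/-! ### Democratic families -/

/-- A family of (nonzero) vectors in a normed space is democratic if there is `D > 0` such that,
for any two finite subfamilies of the same cardinality, the norms of the sums of the normalized
vectors are comparable up to the factor `D`. -/
def IsDemocratic {ι X : Type*} [NormedAddCommGroup X] [NormedSpace ℂ X] (f : ι → X) : Prop :=
  ∃ D : ℝ, 0 < D ∧ ∀ Γ₁ Γ₂ : Finset ι, Γ₁.card = Γ₂.card →
    ‖∑ i ∈ Γ₁, ((‖f i‖⁻¹ : ℝ) : ℂ) • f i‖ ≤ D * ‖∑ i ∈ Γ₂, ((‖f i‖⁻¹ : ℝ) : ℂ) • f i‖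

/-! ### Fourier analysis on a discrete abelian group `L` and its compact dual -/

section Discrete

variable (L : Type*) [AddCommGroup L] [TopologicalSpace L]

/-- The dual group of `L` (written multiplicatively): all characters of `L`, with the topology of
uniform convergence on compact (here: finite) sets. -/
abbrev DualGroup : Type _ := PontryaginDual (Multiplicative L)

instance instMeasurableSpaceDualGroup : MeasurableSpace (DualGroup L) := borel _

instance instBorelSpaceDualGroup : BorelSpace (DualGroup L) := ⟨rfl⟩

variable {L}

/-- The bi-character `e(k, τ) = τ(k)`. -/
def bichar (k : L) (τ : DualGroup L) : Circle := τ (Multiplicative.ofAdd k)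

/-- The orthogonal complement `M^⊥` of a subgroup `M` of `L`, as a subset of the dual group. -/
def orthCompl (M : AddSubgroup L) : Set (DualGroup L) := {τ | ∀ k ∈ M, bichar k τ = 1}

/-- `g_Γ(τ) = (1 / card Γ) |∑_{k ∈ Γ} e(k, τ)|²`. -/
def g (Γ : Finset L) (τ : DualGroup L) : ℝ :=
  (Γ.card : ℝ)⁻¹ * ‖∑ k ∈ Γ, (bichar k τ : ℂ)‖ ^ 2

variable (L) in
/-- The space `ℓ²(L)`, i.e. `L²` of the discrete group `L` with counting (Haar) measure. -/
abbrev EllTwo : Type _ := lp (fun _ : L => ℂ) 2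

/-- The translate `(T_y f)(x) = f (x - y)` of a square-summable function on `L`. -/
def translateBy (y : L) (f : EllTwo L) : EllTwo L :=
  ⟨fun x => f (x - y), by
    have h := (lp.memℓp f).summable (by norm_num)
    refine memℓp_gen ?_
    exact h.comp_injective (sub_left_injective (b := y))⟩

theorem continuous_bichar (k : L) : Continuous (bichar k : DualGroup L → Circle) :=
  (ContinuousEvalConst.continuous_eval_const
    (F := Multiplicative L →ₜ* Circle) (Multiplicative.ofAdd k))

variable (L) [DiscreteTopology L]

/-- The Haar measure on the compact dual group, normalized to have total mass one. -/
def dualHaar : Measure (DualGroup L) := Measure.haarMeasure ⊤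

variable {L}

instance instIsProbabilityMeasureDualHaar : IsProbabilityMeasure (dualHaar L) :=
  ⟨by
    have h := Measure.haarMeasure_self (G := DualGroup L) (K₀ := ⊤)
    simpa [dualHaar] using h⟩

instance instIsHaarMeasureDualHaar : (dualHaar L).IsHaarMeasure := by
  unfold dualHaar; infer_instance

/-- The continuous function `τ ↦ conj e(k, τ)` on the dual group. -/
def conjChar (k : L) : C(DualGroup L, ℂ) :=
  ⟨fun τ => (starRingEnd ℂ) (bichar k τ : ℂ),
    Complex.continuous_conj.comp (continuous_subtype_val.comp (continuous_bichar k))⟩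

/-- The function `τ ↦ conj e(k, τ)` as an element of `L²` of the dual group. -/
def conjCharLp (k : L) : Lp ℂ 2 (dualHaar L) :=
  ContinuousMap.toLp 2 (dualHaar L) ℂ (conjChar k)

/-- The Fourier transform `ℓ²(L) → L²(L^)`: the extension by continuity of
`f ↦ (τ ↦ ∑_{x ∈ L} f(x) conj e(x, τ))`, given by the (unordered) sum of this series in `L²`. -/
def fourier (f : EllTwo L) : Lp ℂ 2 (dualHaar L) := ∑' x : L, f x • conjCharLp x

/-- The periodization function `p_ψ`. The ambient group is `L` itself, the annihilator of `L` in
the dual group is trivial, and the periodization `∑_{m ∈ L^⊥} |ψ^(τ + m)|²` has the single term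
`|ψ^(τ)|²`. -/
def periodization (ψ : EllTwo L) (τ : DualGroup L) : ℝ := ‖fourier ψ τ‖ ^ 2

end Discrete

/-! ### The Prüfer 2-group -/

/-- The set of all classes of `m / 2^n` (`m` an integer, `n` a natural number) modulo `1`, as a
subgroup of `ℝ / ℤ`. -/
def dyadicSubgroup : AddSubgroup UnitAddCircle where
  carrier := {x | ∃ (n : ℕ) (m : ℤ), x = (((m : ℝ) / 2 ^ n : ℝ) : UnitAddCircle)}
  zero_mem' := ⟨0, 0, by simp⟩
  add_mem' := by
    rintro _ _ ⟨n, m, rfl⟩ ⟨n', m', rfl⟩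
    refine ⟨n + n', m * 2 ^ n' + m' * 2 ^ n, ?_⟩
    rw [← AddCircle.coe_add]
    congr 1
    push_cast
    field_simp
    ring
  neg_mem' := by
    rintro _ ⟨n, m, rfl⟩
    refine ⟨n, -m, ?_⟩
    rw [← AddCircle.coe_neg]
    congr 1
    push_cast
    ring

/-- The Prüfer 2-group `ℤ(2^∞)`, regarded below as a discrete group. -/
def PruferTwo : Type := dyadicSubgroup

namespace PruferTwo

instance : AddCommGroup PruferTwo := inferInstanceAs (AddCommGroup dyadicSubgroup)

instance : DecidableEq PruferTwo := Classical.decEq _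

instance : TopologicalSpace PruferTwo := ⊥

instance : DiscreteTopology PruferTwo := ⟨rfl⟩

/-- The inclusion of the Prüfer 2-group in `ℝ / ℤ`. -/
def val : PruferTwo →+ UnitAddCircle := dyadicSubgroup.subtype

/-- The subgroup `M_n = {m / 2^n : m ∈ ℤ, 0 ≤ m < 2^n}` (modulo `1`; the range of `m` may be
taken to be all integers). -/
def M (n : ℕ) : AddSubgroup PruferTwo where
  carrier := {x | ∃ m : ℤ, x.val = (((m : ℝ) / 2 ^ n : ℝ) : UnitAddCircle)}
  zero_mem' := ⟨0, by simp⟩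
  add_mem' := by
    rintro x y ⟨m, hm⟩ ⟨m', hm'⟩
    refine ⟨m + m', ?_⟩
    rw [map_add, hm, hm', ← AddCircle.coe_add]
    congr 1
    push_cast
    ring
  neg_mem' := by
    rintro x ⟨m, hm⟩
    refine ⟨-m, ?_⟩
    rw [map_neg, hm, ← AddCircle.coe_neg]
    congr 1
    push_cast
    ring

/-- The set `⋃_{i ≥ 0} (M_{2i}^⊥ \ M_{2i+1}^⊥)`. -/
def layerSet : Set (DualGroup PruferTwo) :=
  ⋃ i : ℕ, orthCompl (M (2 * i)) \ orthCompl (M (2 * i + 1))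

/-- The sumset `Γ_n = {0, s_1} + {0, s_3} + ⋯ + {0, s_{2n-1}}`. -/
def gammaSet (s : ℕ → PruferTwo) (n : ℕ) : Finset PruferTwo :=
  ∑ j ∈ Finset.range n, ({0, s (2 * j + 1)} : Finset PruferTwo)

/-! The series defining the Fourier transform converges, since the characters are orthonormal. -/

theorem val_injective : Function.Injective val := Subtype.val_injective

/-- The tautological character of the Prüfer 2-group. -/
def stdChar : DualGroup PruferTwo :=
  (⟨⟨⟨fun x => AddCircle.toCircle (val x.toAdd), by simp⟩,
    fun x y => by simp [AddCircle.toCircle_add]⟩, continuous_of_discreteTopology⟩ :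
    Multiplicative PruferTwo →ₜ* Circle)

theorem bichar_stdChar_ne_one {k : PruferTwo} (hk : k ≠ 0) : bichar k stdChar ≠ 1 := by
  intro h
  apply hk
  apply val_injective
  apply AddCircle.injective_toCircle (T := (1 : ℝ)) one_ne_zero
  have h' : AddCircle.toCircle (val k) = 1 := h
  simpa using h'

theorem integral_bichar {k : PruferTwo} (hk : k ≠ 0) :
    ∫ τ, (bichar k τ : ℂ) ∂(dualHaar PruferTwo) = 0 := by
  have h : ∫ τ, (bichar k (stdChar * τ) : ℂ) ∂(dualHaar PruferTwo) =
      ∫ τ, (bichar k τ : ℂ) ∂(dualHaar PruferTwo) :=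
    integral_mul_left_eq_self (fun τ => (bichar k τ : ℂ)) stdChar
  have h2 : ∀ τ, (bichar k (stdChar * τ) : ℂ) = (bichar k stdChar : ℂ) * (bichar k τ : ℂ) :=
    fun τ => Circle.coe_mul _ _
  simp_rw [h2] at h
  rw [integral_const_mul] at h
  have h3 : (bichar k stdChar : ℂ) ≠ 1 := by
    intro h3
    exact bichar_stdChar_ne_one hk (Circle.ext (by simpa using h3))
  have h4 : ((bichar k stdChar : ℂ) - 1) *
      ∫ τ, (bichar k τ : ℂ) ∂(dualHaar PruferTwo) = 0 := by
    rw [sub_mul, h, one_mul, sub_self]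
  exact (mul_eq_zero.mp h4).resolve_left (sub_ne_zero.mpr h3)

theorem orthonormal_conjCharLp :
    Orthonormal ℂ (conjCharLp : PruferTwo → Lp ℂ 2 (dualHaar PruferTwo)) := by
  rw [orthonormal_iff_ite]
  intro i j
  have h : ∀ τ : DualGroup PruferTwo,
      conjChar j τ * (starRingEnd ℂ) (conjChar i τ) = (bichar (i - j) τ : ℂ) := by
    intro τ
    have h1 : bichar (i - j) τ = bichar i τ / bichar j τ :=
      map_div τ (Multiplicative.ofAdd i) (Multiplicative.ofAdd j)
    rw [h1, Circle.coe_div, div_eq_mul_inv, ← Circle.coe_inv, Circle.coe_inv_eq_conj, mul_comm]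
    simp [conjChar]
  unfold conjCharLp
  rw [ContinuousMap.inner_toLp]
  simp_rw [h]
  split_ifs with hij
  · subst hij
    have : ∀ τ : DualGroup PruferTwo, (bichar (i - i) τ : ℂ) = 1 := by
      intro τ
      have : bichar (i - i) τ = 1 := by
        rw [sub_self]; exact map_one τ
      rw [this, Circle.coe_one]
    simp_rw [this]
    simp
  · exact integral_bichar (sub_ne_zero.mpr hij)

theorem hasSum_fourier (f : EllTwo PruferTwo) :
    HasSum (fun x => f x • conjCharLp x) (fourier f) := by
  have h := (orthonormal_conjCharLp.orthogonalFamily).summable_of_lp f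
  exact (by simpa using h : Summable fun x => f x • conjCharLp x).hasSum

end PruferTwo

end LatticeTranslates

end

open LatticeTranslates LatticeTranslates.PruferTwo

/-!
Write `μ` for the Haar measure and `E` for `layerSet`, the disjoint union of the sets
`layer i = M_{2i}^⊥ \ M_{2i+1}^⊥`.

*Fourier analysis.* By the Stone–Weierstrass theorem the characters form a Hilbert basis of `L²` of
the dual group (`charBasis`), so the Fourier transform is unitary. Hence the indicator of `E` is the
transform of some `ψ`, and since translations become multiplications by characters, Plancherel gives
`‖∑_{k ∈ Γ} T_k ψ‖² = card Γ · ∫ g_Γ p_ψ` (`norm_sq_sum_translateBy`). Democracy is therefore a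
question about the integrals of `g_Γ` over `E`.

*Subgroups.* A character sum over a finite subgroup `H` is `card H` on `H^⊥` and `0` elsewhere.
Thus `μ (M_n^⊥) = 2⁻ⁿ` and `∫_E g_{M_n} = 2ⁿ μ (E ∩ M_n^⊥)`, where `E ∩ M_n^⊥` consists of the
layers with `2i ≥ n`; a geometric series gives `2/3` or `1/3` according to the parity of `n`
(`integral_g_finsetM`). Every finite subgroup is some `M_n` (`exists_eq_M_of_finite`), because an
element of `M_{n+1}` outside `M_n` has order `2^{n+1}` and so generates `M_{n+1}`.

*The sumsets `Γ_n`.* The sums defining `Γ_n` are distinct, so `card Γ_n = 2ⁿ` and the character sum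
over `Γ_n` is the product of the factors `1 + e(s_{2i+1}, τ)` with `i < n`. On `layer i` the
character of `s_{2i+1}` is `-1` (`bichar_eq_neg_one_of_mem_layer`), so `g_{Γ_n}` vanishes on the
first `n` layers. On the others it is at most `2ⁿ`, and these have measure `(2/3) 4⁻ⁿ`; hence the
bound `integral_g_gammaSet_le`. Comparing `Γ_n` with `M_n`, which has the same cardinality, refutes
democracy.
-/

open LatticeTranslates LatticeTranslates.PruferTwo

namespace LatticeTranslates.PruferTwo

/-! ### The finite subgroups of the Prüfer 2-group -/

/-- The class of `1 / 2^n`, the standard generator of `M n`. -/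
noncomputable def gen (n : ℕ) : PruferTwo :=
  (⟨((1 / 2 ^ n : ℝ) : UnitAddCircle), n, 1, by simp⟩ : dyadicSubgroup)

theorem val_gen (n : ℕ) : (gen n).val = ((1 / 2 ^ n : ℝ) : UnitAddCircle) := rfl

theorem addOrderOf_gen (n : ℕ) : addOrderOf (gen n) = 2 ^ n := by
  rw [← addOrderOf_injective val val_injective, val_gen]
  have h := AddCircle.addOrderOf_period_div (p := (1 : ℝ)) (n := 2 ^ n) (by positivity)
  push_cast at h
  exact h

theorem M_eq_zmultiples_gen (n : ℕ) : M n = AddSubgroup.zmultiples (gen n) := by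
  ext x
  rw [AddSubgroup.mem_zmultiples_iff]
  refine exists_congr fun m => ?_
  have h : (m • gen n).val = (((m : ℝ) / 2 ^ n : ℝ) : UnitAddCircle) := by
    rw [map_zsmul, val_gen, ← AddCircle.coe_zsmul]
    congr 1
    simp [div_eq_mul_inv]
  rw [← h]
  exact val_injective.eq_iff.trans eq_comm

theorem card_M (n : ℕ) : Nat.card (M n) = 2 ^ n := by
  rw [M_eq_zmultiples_gen, Nat.card_zmultiples, addOrderOf_gen]

instance finite_M (n : ℕ) : Finite (M n) :=
  Nat.finite_of_card_ne_zero (by rw [card_M]; positivity)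

theorem mem_M_iff_nsmul {n : ℕ} {x : PruferTwo} : x ∈ M n ↔ 2 ^ n • x = 0 := by
  constructor
  · rw [M_eq_zmultiples_gen, AddSubgroup.mem_zmultiples_iff]
    rintro ⟨m, rfl⟩
    rw [smul_comm, ← addOrderOf_gen, addOrderOf_nsmul_eq_zero, smul_zero]
  · intro h
    obtain ⟨r, hr⟩ := QuotientAddGroup.mk_surjective (x.val)
    have hr' : x.val = (r : UnitAddCircle) := hr.symm
    have h2 : ((2 ^ n • r : ℝ) : UnitAddCircle) = 0 := by
      rw [AddCircle.coe_nsmul, ← hr', ← map_nsmul, h, map_zero]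
    obtain ⟨m, hm⟩ := (AddCircle.coe_eq_zero_iff (1 : ℝ)).1 h2
    refine ⟨m, ?_⟩
    rw [hr']
    congr 1
    rw [eq_div_iff (by positivity)]
    simp only [zsmul_eq_mul, mul_one, nsmul_eq_mul, Nat.cast_pow, Nat.cast_ofNat] at hm
    linarith

theorem M_mono : Monotone M := by
  intro a b hab x hx
  rw [mem_M_iff_nsmul] at hx ⊢
  obtain ⟨c, rfl⟩ := Nat.exists_eq_add_of_le hab
  rw [pow_add, mul_comm, mul_smul, hx, smul_zero]

theorem exists_mem_M (x : PruferTwo) : ∃ n, x ∈ M n := by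
  obtain ⟨n, m, h⟩ := x.2
  exact ⟨n, m, h⟩

theorem M_zero : M 0 = ⊥ := by
  ext x
  simp [mem_M_iff_nsmul]

theorem gen_mem_M (n : ℕ) : gen n ∈ M n := by
  rw [M_eq_zmultiples_gen]
  exact AddSubgroup.mem_zmultiples _

theorem gen_succ_notMem_M (n : ℕ) : gen (n + 1) ∉ M n := by
  rw [mem_M_iff_nsmul, ← addOrderOf_dvd_iff_nsmul_eq_zero, addOrderOf_gen]
  intro h
  exact absurd (Nat.pow_dvd_pow_iff_le_right'.1 h) (by omega)

/-- Every element of `M (n + 1)` outside `M n` has order `2 ^ (n + 1)`, hence generates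
`M (n + 1)`. -/
theorem zmultiples_eq_M {n : ℕ} {x : PruferTwo} (hx : x ∈ M (n + 1)) (hx' : x ∉ M n) :
    AddSubgroup.zmultiples x = M (n + 1) := by
  have ho : addOrderOf x = 2 ^ (n + 1) :=
    haveI : Fact (Nat.Prime 2) := ⟨Nat.prime_two⟩
    addOrderOf_eq_prime_pow (mt mem_M_iff_nsmul.2 hx') (mem_M_iff_nsmul.1 hx)
  refine AddSubgroup.eq_of_le_of_card_ge ?_ ?_
  · simpa using hx
  · rw [card_M, Nat.card_zmultiples, ho]

theorem exists_eq_M_of_finite (H : AddSubgroup PruferTwo) (hH : (H : Set PruferTwo).Finite) :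
    ∃ n, H = M n := by
  classical
  have hex : ∃ n, H ≤ M n := by
    choose f hf using exists_mem_M
    obtain ⟨N, hN⟩ := (hH.image f).bddAbove
    exact ⟨N, fun x hx => M_mono (hN ⟨x, hx, rfl⟩) (hf x)⟩
  obtain ⟨n, hn, hmin⟩ : ∃ n, H ≤ M n ∧ ∀ m < n, ¬ H ≤ M m :=
    ⟨Nat.find hex, Nat.find_spec hex, fun m hm => Nat.find_min hex hm⟩
  refine ⟨n, le_antisymm hn ?_⟩
  rcases n with - | n
  · rw [M_zero]
    exact bot_le
  · obtain ⟨x, hxH, hx⟩ := SetLike.not_le_iff_exists.1 (hmin n n.lt_succ_self)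
    rw [← zmultiples_eq_M (hn hxH) hx]
    simpa using hxH

/-- The subgroup `M n` as a finite set. -/
noncomputable def finsetM (n : ℕ) : Finset PruferTwo :=
  Set.Finite.toFinset (s := (M n : Set PruferTwo)) (finite_M n)

@[simp] theorem coe_finsetM (n : ℕ) : (finsetM n : Set PruferTwo) = M n :=
  Set.Finite.coe_toFinset _

@[simp] theorem mem_finsetM {n : ℕ} {x : PruferTwo} : x ∈ finsetM n ↔ x ∈ M n :=
  Set.Finite.mem_toFinset _

theorem card_finsetM (n : ℕ) : (finsetM n).card = 2 ^ n := by
  rw [← card_M, finsetM]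
  exact (Nat.card_eq_card_finite_toFinset (s := (M n : Set PruferTwo)) (finite_M n)).symm

/-! ### Character sums over subgroups and the measure of the layers -/

theorem bichar_zero (τ : DualGroup PruferTwo) : bichar 0 τ = 1 := map_one τ

theorem bichar_add (k l : PruferTwo) (τ : DualGroup PruferTwo) :
    bichar (k + l) τ = bichar k τ * bichar l τ :=
  map_mul τ (Multiplicative.ofAdd k) (Multiplicative.ofAdd l)

theorem bichar_neg (k : PruferTwo) (τ : DualGroup PruferTwo) :
    bichar (-k) τ = (bichar k τ)⁻¹ :=
  map_inv τ (Multiplicative.ofAdd k)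

theorem bichar_zsmul (m : ℤ) (k : PruferTwo) (τ : DualGroup PruferTwo) :
    bichar (m • k) τ = bichar k τ ^ m :=
  map_zpow τ (Multiplicative.ofAdd k) m

theorem isClosed_orthCompl (H : AddSubgroup PruferTwo) : IsClosed (orthCompl H) := by
  simp only [orthCompl, Set.ofPred_forall]
  exact isClosed_iInter fun k => isClosed_iInter fun _ =>
    isClosed_eq (continuous_bichar k) continuous_const

theorem measurableSet_orthCompl (H : AddSubgroup PruferTwo) : MeasurableSet (orthCompl H) :=
  (isClosed_orthCompl H).measurableSet

theorem orthCompl_anti {H K : AddSubgroup PruferTwo} (h : H ≤ K) : orthCompl K ⊆ orthCompl H :=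
  fun _ hτ k hk => hτ k (h hk)

theorem sum_bichar_of_mem_orthCompl {H : AddSubgroup PruferTwo} {Γ : Finset PruferTwo}
    (hΓ : (Γ : Set PruferTwo) ⊆ H) {τ : DualGroup PruferTwo} (hτ : τ ∈ orthCompl H) :
    ∑ k ∈ Γ, (bichar k τ : ℂ) = Γ.card := by
  rw [Finset.sum_congr rfl fun k hk => by rw [hτ k (hΓ hk), Circle.coe_one]]
  simp

theorem sum_bichar_of_notMem_orthCompl {H : AddSubgroup PruferTwo} {Γ : Finset PruferTwo}
    (hΓ : (Γ : Set PruferTwo) = H) {τ : DualGroup PruferTwo} (hτ : τ ∉ orthCompl H) :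
    ∑ k ∈ Γ, (bichar k τ : ℂ) = 0 := by
  have hmem : ∀ k, k ∈ Γ ↔ k ∈ H := fun k => by rw [← Finset.mem_coe, hΓ, SetLike.mem_coe]
  obtain ⟨h, hh, hne⟩ : ∃ h ∈ H, bichar h τ ≠ 1 := by
    simpa [orthCompl] using hτ
  -- translation by `h` permutes `Γ` and multiplies the sum by `bichar h τ ≠ 1`
  have hshift : ∑ k ∈ Γ, (bichar k τ : ℂ) = bichar h τ * ∑ k ∈ Γ, (bichar k τ : ℂ) := by
    rw [Finset.mul_sum]
    refine (Finset.sum_equiv (Equiv.addLeft h) (fun k => ?_) fun k _ => ?_).symm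
    · simp [hmem, AddSubgroup.add_mem_cancel_left _ hh]
    · simp [bichar_add]
  have hne' : (bichar h τ : ℂ) - 1 ≠ 0 := fun e =>
    hne (Circle.ext (by simpa using sub_eq_zero.1 e))
  refine (mul_eq_zero.1 (?_ : ((bichar h τ : ℂ) - 1) * _ = 0)).resolve_left hne'
  rw [sub_mul, one_mul, ← hshift, sub_self]

theorem sum_bichar_finsetM (n : ℕ) (τ : DualGroup PruferTwo) :
    ∑ k ∈ finsetM n, (bichar k τ : ℂ) = (orthCompl (M n)).indicator (fun _ => 2 ^ n) τ := by
  by_cases h : τ ∈ orthCompl (M n)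
  · rw [sum_bichar_of_mem_orthCompl (by simp) h, Set.indicator_of_mem h, card_finsetM]
    simp
  · rw [sum_bichar_of_notMem_orthCompl (by simp) h, Set.indicator_of_notMem h]

theorem integrable_of_continuous {E : Type*} [NormedAddCommGroup E]
    {f : DualGroup PruferTwo → E} (hf : Continuous f) :
    Integrable f (dualHaar PruferTwo) :=
  hf.integrable_of_hasCompactSupport (HasCompactSupport.of_compactSpace f)

theorem continuous_coe_bichar (k : PruferTwo) :
    Continuous fun τ : DualGroup PruferTwo => (bichar k τ : ℂ) :=
  continuous_subtype_val.comp (continuous_bichar k)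

theorem measureReal_orthCompl_M (n : ℕ) :
    (dualHaar PruferTwo).real (orthCompl (M n)) = (2 ^ n)⁻¹ := by
  have h1 : ∫ τ, ∑ k ∈ finsetM n, (bichar k τ : ℂ) ∂(dualHaar PruferTwo) = 1 := by
    rw [integral_finsetSum _ fun k _ => integrable_of_continuous (continuous_coe_bichar k),
      Finset.sum_eq_single_of_mem 0 (by simp [zero_mem]) fun k _ hk => integral_bichar hk]
    simp [bichar_zero]
  simp_rw [sum_bichar_finsetM] at h1
  rw [integral_indicator_const _ (measurableSet_orthCompl _), Complex.real_smul] at h1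
  rw [← mul_eq_one_iff_eq_inv₀ (by positivity)]
  exact_mod_cast h1

/-- The set `M_{2i}^⊥ \ M_{2i+1}^⊥`. -/
def layer (i : ℕ) : Set (DualGroup PruferTwo) := orthCompl (M (2 * i)) \ orthCompl (M (2 * i + 1))

theorem measurableSet_layer (i : ℕ) : MeasurableSet (layer i) :=
  (measurableSet_orthCompl _).diff (measurableSet_orthCompl _)

theorem layerSet_eq_iUnion : layerSet = ⋃ i, layer i := rfl

theorem measurableSet_layerSet : MeasurableSet layerSet :=
  .iUnion measurableSet_layer

theorem measureReal_layer (i : ℕ) :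
    (dualHaar PruferTwo).real (layer i) = (1 / 2) * (1 / 4) ^ i := by
  rw [layer, measureReal_sdiff (orthCompl_anti (M_mono (by omega))) (measurableSet_orthCompl _),
    measureReal_orthCompl_M, measureReal_orthCompl_M, pow_succ, pow_mul, one_div_pow]
  norm_num
  ring

theorem layer_subset_orthCompl {i n : ℕ} (h : n ≤ 2 * i) : layer i ⊆ orthCompl (M n) :=
  Set.sdiff_subset.trans (orthCompl_anti (M_mono h))

theorem disjoint_layer_orthCompl {i n : ℕ} (h : 2 * i < n) :
    Disjoint (layer i) (orthCompl (M n)) :=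
  Set.disjoint_sdiff_left.mono_right (orthCompl_anti (M_mono h))

theorem pairwise_disjoint_layer : Pairwise (Function.onFun Disjoint layer) := by
  refine (pairwise_disjoint_on _).2 fun i j hij => ?_
  exact (disjoint_layer_orthCompl (n := 2 * j) (by omega)).mono_right
    (layer_subset_orthCompl le_rfl)

/-- Only the layers with `2 * i ≥ n` meet the annihilator of `M n`, and they are contained in it;
their measures form a geometric series of ratio `1 / 4`. -/
theorem measureReal_layerSet_inter (m n : ℕ) (hn : n ≤ 2 * m) (hm : 2 * m < n + 2) :
    (dualHaar PruferTwo).real (layerSet ∩ orthCompl (M n)) = (2 / 3) * (1 / 4) ^ m := by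
  have hset : layerSet ∩ orthCompl (M n) = ⋃ i, layer (m + i) := by
    ext τ
    simp only [layerSet_eq_iUnion, Set.mem_inter_iff, Set.mem_iUnion]
    constructor
    · rintro ⟨⟨i, hi⟩, hτ⟩
      have hmi : m ≤ i := by
        by_contra! hlt
        exact (disjoint_layer_orthCompl (by omega)).ne_of_mem hi hτ rfl
      exact ⟨i - m, by rwa [Nat.add_sub_cancel' hmi]⟩
    · rintro ⟨i, hi⟩
      exact ⟨⟨_, hi⟩, layer_subset_orthCompl (by omega) hi⟩
  have hsum : HasSum (fun i => (dualHaar PruferTwo).real (layer (m + i)))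
      ((dualHaar PruferTwo).real (⋃ i, layer (m + i))) := by
    have hU := measure_iUnion (μ := dualHaar PruferTwo)
      (pairwise_disjoint_layer.comp_of_injective (add_right_injective m))
      fun i => measurableSet_layer (m + i)
    rw [measureReal_def, hU, ENNReal.tsum_toReal_eq fun _ => measure_ne_top _ _]
    exact ENNReal.hasSum_toReal (hU ▸ measure_ne_top _ _)
  have hgeo : HasSum (fun i => (dualHaar PruferTwo).real (layer (m + i)))
      ((1 / 2) * (1 / 4) ^ m * (1 - 1 / 4)⁻¹) := by
    simp_rw [measureReal_layer, pow_add, ← mul_assoc]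
    exact (hasSum_geometric_of_lt_one (by norm_num) (by norm_num)).mul_left _
  rw [hset, hsum.unique hgeo]
  ring

/-! ### The Fourier transform as a unitary operator -/

theorem conjChar_apply (k : PruferTwo) (τ : DualGroup PruferTwo) :
    conjChar k τ = (starRingEnd ℂ) (bichar k τ : ℂ) := rfl

theorem conjChar_add (k l : PruferTwo) : conjChar (k + l) = conjChar k * conjChar l := by
  ext τ
  simp [conjChar_apply, bichar_add]

theorem conjChar_zero : conjChar (0 : PruferTwo) = 1 := by
  ext τ
  simp [conjChar_apply, bichar_zero]

theorem conjChar_neg (k : PruferTwo) : conjChar (-k) = star (conjChar k) := by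
  ext τ
  rw [conjChar_apply, bichar_neg, Circle.coe_inv_eq_conj]
  rfl

/-- The star subalgebra of continuous functions on the dual group generated by the characters. -/
noncomputable def charSubalgebra : StarSubalgebra ℂ C(DualGroup PruferTwo, ℂ) where
  toSubalgebra := Algebra.adjoin ℂ (Set.range conjChar)
  star_mem' := by
    change Algebra.adjoin ℂ (Set.range (conjChar : PruferTwo → C(DualGroup PruferTwo, ℂ))) ≤
      star (Algebra.adjoin ℂ (Set.range conjChar))
    refine Algebra.adjoin_le ?_
    rintro - ⟨k, rfl⟩
    exact Algebra.subset_adjoin ⟨-k, conjChar_neg k⟩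

theorem toSubmodule_charSubalgebra :
    Subalgebra.toSubmodule charSubalgebra.toSubalgebra =
      Submodule.span ℂ (Set.range (conjChar : PruferTwo → C(DualGroup PruferTwo, ℂ))) := by
  apply Algebra.adjoin_eq_span_of_subset
  refine Set.Subset.trans ?_ Submodule.subset_span
  intro x hx
  refine Submonoid.closure_induction (fun _ => id) ⟨0, conjChar_zero⟩ ?_ hx
  rintro - - - - ⟨k, rfl⟩ ⟨l, rfl⟩
  exact ⟨k + l, conjChar_add k l⟩

theorem charSubalgebra_separatesPoints : charSubalgebra.SeparatesPoints := by
  intro τ σ hne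
  obtain ⟨k, hk⟩ : ∃ k : PruferTwo, bichar k τ ≠ bichar k σ := by
    by_contra! h
    exact hne (PontryaginDual.ext fun a => h a.toAdd)
  refine ⟨_, ⟨conjChar k, Algebra.subset_adjoin ⟨k, rfl⟩, rfl⟩, fun h => hk ?_⟩
  exact Circle.ext (star_injective h)

theorem span_conjChar_closure_eq_top :
    (Submodule.span ℂ (Set.range
      (conjChar : PruferTwo → C(DualGroup PruferTwo, ℂ)))).topologicalClosure = ⊤ := by
  rw [← toSubmodule_charSubalgebra]
  exact congr_arg (Subalgebra.toSubmodule <| StarSubalgebra.toSubalgebra ·)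
    (ContinuousMap.starSubalgebra_topologicalClosure_eq_top_of_separatesPoints charSubalgebra
      charSubalgebra_separatesPoints)

instance regular_dualHaar : (dualHaar PruferTwo).Regular := by
  unfold dualHaar; infer_instance

theorem span_conjCharLp_closure_eq_top :
    (Submodule.span ℂ (Set.range
      (conjCharLp : PruferTwo → Lp ℂ 2 (dualHaar PruferTwo)))).topologicalClosure = ⊤ := by
  convert!
    (ContinuousMap.toLp_denseRange ℂ (dualHaar PruferTwo) ℂ
      ENNReal.ofNat_ne_top).topologicalClosure_map_submodule span_conjChar_closure_eq_top
  rw [Submodule.map_span, ← Set.range_comp]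
  rfl

/-- The characters form a Hilbert basis of `L²` of the dual group. -/
noncomputable def charBasis : HilbertBasis PruferTwo ℂ (Lp ℂ 2 (dualHaar PruferTwo)) :=
  HilbertBasis.mk orthonormal_conjCharLp span_conjCharLp_closure_eq_top.ge

theorem charBasis_apply (k : PruferTwo) : charBasis k = conjCharLp k := by simp [charBasis]

theorem fourier_eq_repr_symm (f : EllTwo PruferTwo) : fourier f = charBasis.repr.symm f := by
  have h := charBasis.hasSum_repr_symm f
  simp_rw [charBasis_apply] at h
  exact (hasSum_fourier f).unique h

theorem fourier_surjective (F : Lp ℂ 2 (dualHaar PruferTwo)) :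
    ∃ f : EllTwo PruferTwo, fourier f = F :=
  ⟨charBasis.repr F, by simp [fourier_eq_repr_symm]⟩

theorem norm_fourier (f : EllTwo PruferTwo) : ‖fourier f‖ = ‖f‖ := by
  rw [fourier_eq_repr_symm, LinearIsometryEquiv.norm_map]

theorem fourier_sum {ι : Type*} (s : Finset ι) (f : ι → EllTwo PruferTwo) :
    fourier (∑ i ∈ s, f i) = ∑ i ∈ s, fourier (f i) := by
  simp only [fourier_eq_repr_symm, map_sum]

theorem coeFn_conjCharLp (k : PruferTwo) : conjCharLp k =ᵐ[dualHaar PruferTwo] conjChar k :=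
  ContinuousMap.coeFn_toLp _ (conjChar k)

/-- The values of `f` are the Fourier coefficients of `fourier f`. -/
theorem integral_bichar_mul_fourier (f : EllTwo PruferTwo) (k : PruferTwo) :
    ∫ τ, (bichar k τ : ℂ) * fourier f τ ∂(dualHaar PruferTwo) = f k := by
  have h : charBasis.repr (fourier f) k = f k := by simp [fourier_eq_repr_symm]
  rw [← h, charBasis.repr_apply_apply, charBasis_apply, L2.inner_def]
  refine integral_congr_ae ?_
  filter_upwards [coeFn_conjCharLp k] with τ hτ
  rw [hτ]
  simp [conjChar_apply, mul_comm]

/-- The Fourier transform turns translations into multiplication by characters. -/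
theorem fourier_translateBy (k : PruferTwo) (f : EllTwo PruferTwo) :
    fourier (translateBy k f) =ᵐ[dualHaar PruferTwo] fun τ => conjChar k τ * fourier f τ := by
  have hmem : MemLp (fun τ => conjChar k τ * fourier f τ) 2 (dualHaar PruferTwo) := by
    refine (Lp.memLp (fourier f)).of_le
      ((conjChar k).continuous.aestronglyMeasurable.mul (Lp.aestronglyMeasurable _)) ?_
    filter_upwards with τ
    rw [norm_mul, conjChar_apply, RCLike.norm_conj, Circle.norm_coe, one_mul]
  obtain ⟨h, hh⟩ := fourier_surjective hmem.toLp
  suffices translateBy k f = h by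
    rw [this, hh]
    exact hmem.coeFn_toLp
  -- both sides have the same Fourier coefficients
  ext x
  rw [← integral_bichar_mul_fourier h x, hh]
  have h1 : (translateBy k f : PruferTwo → ℂ) x = f (x - k) := rfl
  rw [h1, ← integral_bichar_mul_fourier f (x - k)]
  refine integral_congr_ae ?_
  filter_upwards [hmem.coeFn_toLp] with τ hτ
  rw [hτ, sub_eq_add_neg, bichar_add, bichar_neg, Circle.coe_mul, Circle.coe_inv_eq_conj,
    conjChar_apply, mul_assoc]

theorem norm_sq_eq_integral_periodization (f : EllTwo PruferTwo) :
    ‖f‖ ^ 2 = ∫ τ, periodization f τ ∂(dualHaar PruferTwo) := by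
  rw [← norm_fourier, ← @inner_self_eq_norm_sq ℂ, L2.inner_def,
    ← integral_re (L2.integrable_inner _ _)]
  refine integral_congr_ae ?_
  filter_upwards with τ
  rw [inner_self_eq_norm_sq, periodization]

theorem integrable_periodization (f : EllTwo PruferTwo) :
    Integrable (periodization f) (dualHaar PruferTwo) :=
  (Lp.memLp (fourier f)).integrable_norm_pow (by norm_num)

/-- Plancherel's identity for a sum of translates; it reduces democracy of the translates to a
comparison of the integrals of `g Γ` against the periodization function. -/
theorem norm_sq_sum_translateBy (f : EllTwo PruferTwo) (Γ : Finset PruferTwo) :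
    ‖∑ k ∈ Γ, translateBy k f‖ ^ 2 =
      Γ.card * ∫ τ, g Γ τ * periodization f τ ∂(dualHaar PruferTwo) := by
  rcases Γ.eq_empty_or_nonempty with rfl | hΓ
  · simp
  rw [norm_sq_eq_integral_periodization, ← integral_const_mul]
  refine integral_congr_ae ?_
  have hF : fourier (∑ k ∈ Γ, translateBy k f) =ᵐ[dualHaar PruferTwo]
      fun τ => (∑ k ∈ Γ, conjChar k τ) * fourier f τ := by
    have hall : ∀ᵐ τ ∂(dualHaar PruferTwo), ∀ k ∈ Γ,
        fourier (translateBy k f) τ = conjChar k τ * fourier f τ :=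
      (Filter.eventually_all_finset Γ).2 fun k _ => fourier_translateBy k f
    rw [fourier_sum]
    filter_upwards [hall, Lp.coeFn_finsetSum Γ fun k => fourier (translateBy k f)] with τ h1 h2
    rw [h2, Finset.sum_apply, Finset.sum_mul]
    exact Finset.sum_congr rfl h1
  filter_upwards [hF] with τ hτ
  have hconj : ∑ k ∈ Γ, conjChar k τ = (starRingEnd ℂ) (∑ k ∈ Γ, (bichar k τ : ℂ)) := by
    rw [map_sum]
    rfl
  have hc : (Γ.card : ℝ) ≠ 0 := by exact_mod_cast hΓ.card_ne_zero
  rw [periodization, periodization, hτ, norm_mul, mul_pow, hconj, RCLike.norm_conj, g, ← mul_assoc,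
    ← mul_assoc, mul_inv_cancel₀ hc, one_mul]

theorem norm_translateBy (k : PruferTwo) (f : EllTwo PruferTwo) : ‖translateBy k f‖ = ‖f‖ := by
  have h := norm_sq_sum_translateBy f {k}
  simp only [Finset.sum_singleton, Finset.card_singleton, Nat.cast_one, one_mul, g, inv_one,
    Circle.norm_coe, one_pow, ← norm_sq_eq_integral_periodization] at h
  exact (sq_eq_sq₀ (norm_nonneg _) (norm_nonneg _)).1 h

/-! ### The integrals of `g Γ` over the union of the layers -/

theorem g_nonneg (Γ : Finset PruferTwo) (τ : DualGroup PruferTwo) : 0 ≤ g Γ τ := by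
  unfold g
  positivity

theorem continuous_g (Γ : Finset PruferTwo) : Continuous (g Γ : DualGroup PruferTwo → ℝ) :=
  continuous_const.mul ((continuous_finsetSum Γ fun k _ => continuous_coe_bichar k).norm.pow 2)

theorem g_le_card (Γ : Finset PruferTwo) (τ : DualGroup PruferTwo) : g Γ τ ≤ Γ.card := by
  have h : ‖∑ k ∈ Γ, (bichar k τ : ℂ)‖ ≤ Γ.card := by
    refine (norm_sum_le _ _).trans_eq ?_
    simp only [Circle.norm_coe, Finset.sum_const, nsmul_eq_mul, mul_one]
  rcases Γ.eq_empty_or_nonempty with rfl | hΓ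
  · simp [g]
  have hc : (0 : ℝ) < Γ.card := by exact_mod_cast hΓ.card_pos
  rw [g, inv_mul_le_iff₀ hc, ← sq]
  gcongr

theorem integrable_g_mul_periodization (f : EllTwo PruferTwo) (Γ : Finset PruferTwo) :
    Integrable (fun τ => g Γ τ * periodization f τ) (dualHaar PruferTwo) := by
  refine (integrable_periodization f).bdd_mul (c := Γ.card) (continuous_g Γ).aestronglyMeasurable ?_
  filter_upwards with τ
  rw [Real.norm_of_nonneg (g_nonneg Γ τ)]
  exact g_le_card Γ τ

theorem exists_periodization_eq_indicator {E : Set (DualGroup PruferTwo)} (hE : MeasurableSet E) :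
    ∃ ψ : EllTwo PruferTwo,
      periodization ψ =ᵐ[dualHaar PruferTwo] E.indicator (fun _ => (1 : ℝ)) := by
  obtain ⟨ψ, hψ⟩ := fourier_surjective
    (indicatorConstLp 2 hE (measure_ne_top (dualHaar PruferTwo) E) (1 : ℂ))
  refine ⟨ψ, ?_⟩
  filter_upwards [indicatorConstLp_coeFn (p := 2) (hs := hE)
    (hμs := measure_ne_top (dualHaar PruferTwo) E) (c := (1 : ℂ))] with τ hτ
  rw [periodization, hψ, hτ]
  by_cases h : τ ∈ E <;> simp [h]

section Indicator

variable {ψ : EllTwo PruferTwo}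
  (hψ : periodization ψ =ᵐ[dualHaar PruferTwo] layerSet.indicator (fun _ => (1 : ℝ)))
include hψ

theorem integral_g_mul_periodization (Γ : Finset PruferTwo) :
    ∫ τ, g Γ τ * periodization ψ τ ∂(dualHaar PruferTwo) =
      ∫ τ in layerSet, g Γ τ ∂(dualHaar PruferTwo) := by
  rw [← integral_indicator measurableSet_layerSet]
  refine integral_congr_ae ?_
  filter_upwards [hψ] with τ hτ
  rw [hτ]
  by_cases h : τ ∈ layerSet <;> simp [h]

theorem integral_g_finsetM (n : ℕ) :
    ∫ τ, g (finsetM n) τ * periodization ψ τ ∂(dualHaar PruferTwo) =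
      if Even n then (2 / 3 : ℝ) else (1 / 3 : ℝ) := by
  have hg : (g (finsetM n) : DualGroup PruferTwo → ℝ) =
      (orthCompl (M n)).indicator fun _ => 2 ^ n := by
    ext τ
    rw [g, sum_bichar_finsetM, card_finsetM]
    by_cases h : τ ∈ orthCompl (M n)
    · simp [h]
      field_simp
    · simp [h]
  rw [integral_g_mul_periodization hψ, hg, setIntegral_indicator (measurableSet_orthCompl _),
    setIntegral_const, smul_eq_mul]
  rcases Nat.even_or_odd' n with ⟨m, rfl | rfl⟩
  · rw [measureReal_layerSet_inter m _ le_rfl (by omega), if_pos (even_two_mul m), pow_mul,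
      one_div_pow]
    field_simp
    norm_num
  · rw [measureReal_layerSet_inter (m + 1) _ (by omega) (by omega),
      if_neg (Nat.not_even_bit1 m), pow_succ 2, pow_mul, one_div_pow, pow_succ]
    field_simp
    norm_num
    ring

theorem norm_sq_of_periodization_eq : ‖ψ‖ ^ 2 = 2 / 3 := by
  have h := norm_sq_sum_translateBy ψ (finsetM 0)
  rw [integral_g_finsetM hψ 0, card_finsetM] at h
  have h0 : finsetM 0 = {0} := by
    ext x
    simp [M_zero]
  rw [h0, Finset.sum_singleton, norm_translateBy] at h
  simpa using h

end Indicator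

/-! ### The sumsets `Γ_n` -/

theorem gammaSet_zero (s : ℕ → PruferTwo) : gammaSet s 0 = {0} := by
  simp [gammaSet, Finset.singleton_zero]

theorem gammaSet_succ (s : ℕ → PruferTwo) (n : ℕ) :
    gammaSet s (n + 1) = gammaSet s n ∪ (gammaSet s n).map (addRightEmbedding (s (2 * n + 1))) := by
  ext x
  simp only [gammaSet, Finset.sum_range_succ, Finset.mem_add, Finset.mem_union, Finset.mem_map,
    Finset.mem_insert, Finset.mem_singleton, addRightEmbedding_apply]
  aesop

theorem gammaSet_nonempty (s : ℕ → PruferTwo) (n : ℕ) : (gammaSet s n).Nonempty := by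
  induction n with
  | zero => exact ⟨0, by simp [gammaSet_zero]⟩
  | succ n ih =>
    rw [gammaSet_succ]
    exact ih.mono Finset.subset_union_left

section Gamma

variable {s : ℕ → PruferTwo} (hs : ∀ n : ℕ, 1 ≤ n → s n ∈ M n ∧ s n ∉ M (n - 1))
include hs

theorem gammaSet_subset_M (n : ℕ) : (gammaSet s n : Set PruferTwo) ⊆ M (2 * n) := by
  induction n with
  | zero => simp [gammaSet_zero, zero_mem]
  | succ n ih =>
    rw [gammaSet_succ]
    intro x hx
    simp only [Finset.coe_union, Finset.coe_map, Set.mem_union, Set.mem_image, Finset.mem_coe,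
      addRightEmbedding_apply] at hx
    rcases hx with hx | ⟨y, hy, rfl⟩
    · exact M_mono (by omega) (ih hx)
    · exact add_mem (M_mono (by omega) (ih hy))
        (M_mono (by omega) (hs (2 * n + 1) (by omega)).1)

theorem disjoint_gammaSet_map (n : ℕ) :
    Disjoint (gammaSet s n) ((gammaSet s n).map (addRightEmbedding (s (2 * n + 1)))) := by
  rw [Finset.disjoint_left]
  rintro x hx hx'
  obtain ⟨y, hy, rfl⟩ := Finset.mem_map.1 hx'
  refine (hs (2 * n + 1) (by omega)).2 ?_
  exact (AddSubgroup.add_mem_cancel_left _ (gammaSet_subset_M hs n hy)).1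
    (gammaSet_subset_M hs n hx)

theorem card_gammaSet (n : ℕ) : (gammaSet s n).card = 2 ^ n := by
  induction n with
  | zero => simp [gammaSet_zero]
  | succ n ih =>
    rw [gammaSet_succ, Finset.card_union_of_disjoint (disjoint_gammaSet_map hs n),
      Finset.card_map, ih]
    ring

theorem sum_bichar_gammaSet (n : ℕ) (τ : DualGroup PruferTwo) :
    ∑ k ∈ gammaSet s n, (bichar k τ : ℂ) =
      ∏ j ∈ Finset.range n, (1 + (bichar (s (2 * j + 1)) τ : ℂ)) := by
  induction n with
  | zero => simp [gammaSet_zero, bichar_zero]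
  | succ n ih =>
    rw [gammaSet_succ, Finset.sum_union (disjoint_gammaSet_map hs n), Finset.sum_map,
      Finset.prod_range_succ, ← ih]
    simp only [addRightEmbedding_apply, bichar_add, Circle.coe_mul, ← Finset.sum_mul]
    ring

/-- On the layer `i` the character of `s (2 * i + 1)` has square `1`, because twice
`s (2 * i + 1)` lies in `M (2 * i)`, but it is not `1`, because `s (2 * i + 1)` generates
`M (2 * i + 1)`. -/
theorem bichar_eq_neg_one_of_mem_layer {i : ℕ} {τ : DualGroup PruferTwo} (hτ : τ ∈ layer i) :
    (bichar (s (2 * i + 1)) τ : ℂ) = -1 := by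
  obtain ⟨h1, h2⟩ := hs (2 * i + 1) (by omega)
  have hsq : (bichar (s (2 * i + 1)) τ : ℂ) = 1 ∨ (bichar (s (2 * i + 1)) τ : ℂ) = -1 := by
    suffices h : (bichar (s (2 * i + 1)) τ : ℂ) ^ 2 = 1 by simpa using h
    have hmem : s (2 * i + 1) + s (2 * i + 1) ∈ M (2 * i) := by
      rw [mem_M_iff_nsmul, ← two_nsmul, ← mul_smul, ← pow_succ]
      exact mem_M_iff_nsmul.1 h1
    have h := hτ.1 _ hmem
    rw [bichar_add] at h
    rw [sq, ← Circle.coe_mul, h, Circle.coe_one]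
  refine hsq.resolve_left fun hone => ?_
  refine hτ.2 fun k hk => ?_
  rw [← zmultiples_eq_M h1 h2, AddSubgroup.mem_zmultiples_iff] at hk
  obtain ⟨m, rfl⟩ := hk
  have hone' : bichar (s (2 * i + 1)) τ = 1 := Circle.ext (by simpa using hone)
  rw [bichar_zsmul, hone', one_zpow]

theorem g_gammaSet_eq_zero {i n : ℕ} (hi : i < n) {τ : DualGroup PruferTwo} (hτ : τ ∈ layer i) :
    g (gammaSet s n) τ = 0 := by
  rw [g, sum_bichar_gammaSet hs, Finset.prod_eq_zero (Finset.mem_range.2 hi)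
    (by rw [bichar_eq_neg_one_of_mem_layer hs hτ, add_neg_cancel])]
  simp

/-- `g Γ_n` vanishes on the first `n` layers and is at most `2 ^ n` on the remaining ones, which
lie in the annihilator of `M (2 * n)` and have total measure of order `4⁻ⁿ`. -/
theorem integral_g_gammaSet_le {ψ : EllTwo PruferTwo}
    (hψ : periodization ψ =ᵐ[dualHaar PruferTwo] layerSet.indicator (fun _ => (1 : ℝ))) (n : ℕ) :
    ∫ τ, g (gammaSet s n) τ * periodization ψ τ ∂(dualHaar PruferTwo) ≤
      (2 : ℝ) ^ (-(n : ℤ) + 1) := by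
  have hle : ∀ τ ∈ layerSet,
      g (gammaSet s n) τ ≤ (orthCompl (M (2 * n))).indicator (fun _ => (2 : ℝ) ^ n) τ := by
    intro τ hτ
    obtain ⟨i, hi⟩ := Set.mem_iUnion.1 hτ
    rcases lt_or_ge i n with hin | hin
    · rw [g_gammaSet_eq_zero hs hin hi]
      exact Set.indicator_nonneg (fun _ _ => by positivity) τ
    · rw [Set.indicator_of_mem (layer_subset_orthCompl (by omega) hi)]
      have h := g_le_card (gammaSet s n) τ
      rw [card_gammaSet hs] at h
      exact_mod_cast h
  rw [integral_g_mul_periodization hψ]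
  calc _ ≤ ∫ τ in layerSet, (orthCompl (M (2 * n))).indicator (fun _ => (2 : ℝ) ^ n) τ
        ∂(dualHaar PruferTwo) :=
      setIntegral_mono_on (integrable_of_continuous (continuous_g _)).integrableOn
        ((integrable_const _).indicator (measurableSet_orthCompl _)).integrableOn
        measurableSet_layerSet hle
    _ = (2 / 3) * (2 : ℝ)⁻¹ ^ n := by
      rw [setIntegral_indicator (measurableSet_orthCompl _), setIntegral_const, smul_eq_mul,
        measureReal_layerSet_inter n _ le_rfl (by omega), mul_assoc, ← mul_pow]
      norm_num
    _ ≤ (2 : ℝ) ^ (-(n : ℤ) + 1) := by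
      rw [zpow_add₀ two_ne_zero, zpow_neg, zpow_natCast, zpow_one, inv_pow, mul_comm]
      gcongr
      norm_num

end Gamma

/-! ### Infimum over all finite sets and failure of democracy -/

theorem exists_mem_M_notMem :
    ∃ s : ℕ → PruferTwo, ∀ n : ℕ, 1 ≤ n → s n ∈ M n ∧ s n ∉ M (n - 1) := by
  refine ⟨gen, fun n hn => ⟨gen_mem_M n, ?_⟩⟩
  obtain ⟨n, rfl⟩ := Nat.exists_eq_add_of_le' hn
  exact gen_succ_notMem_M n

theorem tendsto_two_zpow_neg_add_one :
    Filter.Tendsto (fun n : ℕ => (2 : ℝ) ^ (-(n : ℤ) + 1)) Filter.atTop (nhds 0) := by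
  have h : (fun n : ℕ => (2 : ℝ) ^ (-(n : ℤ) + 1)) = fun n => (2 : ℝ)⁻¹ ^ n * 2 := by
    ext n
    rw [zpow_add₀ two_ne_zero, zpow_neg, zpow_natCast, zpow_one, inv_pow]
  rw [h]
  simpa using (tendsto_pow_atTop_nhds_zero_of_lt_one (by norm_num : (0 : ℝ) ≤ 2⁻¹)
    (by norm_num)).mul_const 2

section Conclusions

variable {ψ : EllTwo PruferTwo}
  (hψ : periodization ψ =ᵐ[dualHaar PruferTwo] layerSet.indicator (fun _ => (1 : ℝ)))
include hψ

theorem isGLB_integral_g_mul_periodization :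
    IsGLB {r : ℝ | ∃ Γ : Finset PruferTwo, Γ.Nonempty ∧
      r = ∫ τ, g Γ τ * periodization ψ τ ∂(dualHaar PruferTwo)} 0 := by
  obtain ⟨s, hs⟩ := exists_mem_M_notMem
  constructor
  · rintro r ⟨Γ, -, rfl⟩
    exact integral_nonneg fun τ => mul_nonneg (g_nonneg Γ τ) (by unfold periodization; positivity)
  · intro b hb
    exact ge_of_tendsto' tendsto_two_zpow_neg_add_one fun n =>
      (hb ⟨_, gammaSet_nonempty s n, rfl⟩).trans (integral_g_gammaSet_le hs hψ n)

/-- The sets `M n` and `Γ_n` both have `2 ^ n` elements, but the ratio of the squared norms of the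
two sums of translates is at least of order `2 ^ n`. -/
theorem not_isDemocratic_translateBy :
    ¬ IsDemocratic (fun k : PruferTwo => translateBy k ψ) := by
  rintro ⟨D, hD, h⟩
  obtain ⟨s, hs⟩ := exists_mem_M_notMem
  have hψ0 : 0 < ‖ψ‖ := by
    have := norm_sq_of_periodization_eq hψ
    refine lt_of_le_of_ne (norm_nonneg _) fun h0 => ?_
    rw [← h0] at this
    norm_num at this
  have hbound : ∀ n : ℕ, (1 / 3 : ℝ) ≤ D ^ 2 * (2 : ℝ) ^ (-(n : ℤ) + 1) := by
    intro n
    have h1 := h (finsetM n) (gammaSet s n) (by rw [card_finsetM, card_gammaSet hs])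
    simp only [norm_translateBy, ← Finset.smul_sum, norm_smul] at h1
    have hc : 0 < ‖((‖ψ‖⁻¹ : ℝ) : ℂ)‖ := by
      rw [Complex.norm_real, norm_pos_iff]
      exact (inv_pos.2 hψ0).ne'
    rw [mul_left_comm, mul_le_mul_iff_right₀ hc] at h1
    have h2 := pow_le_pow_left₀ (norm_nonneg _) h1 2
    rw [mul_pow, norm_sq_sum_translateBy, norm_sq_sum_translateBy, card_finsetM,
      card_gammaSet hs, mul_left_comm, mul_le_mul_iff_right₀ (by positivity),
      integral_g_finsetM hψ] at h2
    calc (1 / 3 : ℝ) ≤ if Even n then (2 / 3 : ℝ) else (1 / 3 : ℝ) := by split_ifs <;> norm_num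
      _ ≤ _ := h2
      _ ≤ _ := by gcongr; exact integral_g_gammaSet_le hs hψ n
  have hlim := ge_of_tendsto' (tendsto_two_zpow_neg_add_one.const_mul (D ^ 2)) hbound
  norm_num at hlim

end Conclusions

end LatticeTranslates.PruferTwo

theorem mainTheorem5 :
    (∃ ψ : EllTwo PruferTwo,
      periodization ψ =ᵐ[dualHaar PruferTwo] layerSet.indicator (fun _ => (1 : ℝ))) ∧
    (∃ s : ℕ → PruferTwo, ∀ n : ℕ, 1 ≤ n → s n ∈ M n ∧ s n ∉ M (n - 1)) ∧
    ∀ ψ : EllTwo PruferTwo,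
      periodization ψ =ᵐ[dualHaar PruferTwo] layerSet.indicator (fun _ => (1 : ℝ)) →
      (∀ k : PruferTwo, translateBy k ψ ≠ 0) ∧
      (∀ Γ : Finset PruferTwo,
        Integrable (fun τ => g Γ τ * periodization ψ τ) (dualHaar PruferTwo)) ∧
      (∀ s : ℕ → PruferTwo, (∀ n : ℕ, 1 ≤ n → s n ∈ M n ∧ s n ∉ M (n - 1)) →
        ∀ n : ℕ, 1 ≤ n →
          ∫ τ, g (gammaSet s n) τ * periodization ψ τ ∂(dualHaar PruferTwo)
            ≤ (2 : ℝ) ^ (-(n : ℤ) + 1)) ∧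
      IsGLB {r : ℝ | ∃ Γ : Finset PruferTwo, Γ.Nonempty ∧
        r = ∫ τ, g Γ τ * periodization ψ τ ∂(dualHaar PruferTwo)} 0 ∧
      ¬ IsDemocratic (fun k : PruferTwo => translateBy k ψ) ∧
      (∀ n : ℕ, ∃ Γ : Finset PruferTwo, (Γ : Set PruferTwo) = M n ∧
        ∫ τ, g Γ τ * periodization ψ τ ∂(dualHaar PruferTwo) =
          if Even n then (2 / 3 : ℝ) else (1 / 3 : ℝ)) ∧
      (∀ (H : AddSubgroup PruferTwo) (Γ : Finset PruferTwo), (Γ : Set PruferTwo) = H →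
        1 / 3 ≤ ∫ τ, g Γ τ * periodization ψ τ ∂(dualHaar PruferTwo)) := by
  refine ⟨exists_periodization_eq_indicator measurableSet_layerSet, exists_mem_M_notMem,
    fun ψ hψ => ⟨fun k hk => ?_, integrable_g_mul_periodization ψ,
      fun s hs n _ => integral_g_gammaSet_le hs hψ n, isGLB_integral_g_mul_periodization hψ,
      not_isDemocratic_translateBy hψ, fun n => ⟨finsetM n, coe_finsetM n,
        integral_g_finsetM hψ n⟩, fun H Γ hΓ => ?_⟩⟩
  · have h := norm_sq_of_periodization_eq hψ
    rw [← norm_translateBy k, hk] at h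
    norm_num at h
  · obtain ⟨n, rfl⟩ := exists_eq_M_of_finite H (hΓ ▸ Γ.finite_toSet)
    obtain rfl : Γ = finsetM n := Finset.coe_injective (hΓ.trans (coe_finsetM n).symm)
    rw [integral_g_finsetM hψ]
    split_ifs <;> norm_num
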